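/- For a probability measure $\mu$ on the unitary group $U(d)$ (an ensemble of random unitaries), its second-order frame potential is $$\mathcal F^{(2)}_\mu=\int\!\!\int \left|\operatorname{tr}(U^\dagger U')\right|^4\,d\mu(U)\,d\mu(U').$$ For integers $0\le N\le d$, the restricted Haar ensemble is the law of the random block-diagonal unitary $$U=\operatorname{diag}(e^{i\phi_1},\dots,e^{i\phi_N})\oplus V\in U(d),$$ where $\phi_1,\dots,\phi_N$ are independent and uniform on $[0,2\pi)$ and $V\in U(d-N)$ is Haar random and independent of the phases. Its second-order frame potential is $$\mathcal F^{(2)}_{\rm RH}=\begin{cases}2N^2+3N+2, & N\le d-2,\\ 2d^2-d, & d-1\le N\le d.\end{cases}$$ In contrast, for $d\ge 2$ the Haar ensemble on $U(d)$ has $\mathcal F^{(2)}_{\rm Haar}=2$, so that $\mathcal F^{(2)}_{\rm Haar}<\mathcal F^{(2)}_{\rm RH}$ whenever $d\ge2$ and $1\le N\le d$. -/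

import Mathlib

open MeasureTheory

noncomputable section

/-- The unitary group `U(n)`, with the topology inherited from the matrices, carries its Borel
σ-algebra. -/
instance unitaryGroupMeasurableSpace (n : Type*) [Fintype n] [DecidableEq n] :
    MeasurableSpace (Matrix.unitaryGroup n ℂ) :=
  borel _

instance unitaryGroupBorelSpace (n : Type*) [Fintype n] [DecidableEq n] :
    BorelSpace (Matrix.unitaryGroup n ℂ) :=
  ⟨rfl⟩

instance unitaryGroupCompactSpace (n : Type*) [Fintype n] [DecidableEq n] :
    CompactSpace (Matrix.unitaryGroup n ℂ) := by
  apply isCompact_iff_compactSpace.mp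
  have hK : IsCompact (Set.matrix (Metric.closedBall (0 : ℂ) 1) : Set (Matrix n n ℂ)) :=
    (isCompact_closedBall _ _).matrix
  refine hK.of_isClosed_subset ?_ ?_
  · have h : ((Matrix.unitaryGroup n ℂ : Submonoid (Matrix n n ℂ)) : Set (Matrix n n ℂ))
        = {A | star A * A = 1} ∩ {A | A * star A = 1} := by
      ext A
      exact Unitary.mem_iff
    rw [h]
    exact (isClosed_eq (by fun_prop) continuous_const).inter
      (isClosed_eq (by fun_prop) continuous_const)
  · intro A hA i j
    simpa using entry_norm_bound_of_unitary hA i j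

/-- The Haar ensemble: the Haar probability measure on `U(n)`. -/
def haarEnsemble (n : Type*) [Fintype n] [DecidableEq n] :
    Measure (Matrix.unitaryGroup n ℂ) :=
  Measure.haarMeasure ⊤

/-- The law of `N` independent phases, each uniformly distributed on `[0, 2π)`. -/
def uniformPhases (N : ℕ) : Measure (Fin N → ℝ) :=
  Measure.pi fun _ => ProbabilityTheory.cond volume (Set.Ico 0 (2 * Real.pi))

/-- The `d × d` block-diagonal matrix `diag(e^{iφ₁}, …, e^{iφ_N}) ⊕ V`, where `N ≤ d` and `V` is a
matrix of size `d - N`. -/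
def blockMatrix {d N : ℕ} (h : N ≤ d) (φ : Fin N → ℝ) (V : Matrix (Fin (d - N)) (Fin (d - N)) ℂ) :
    Matrix (Fin d) (Fin d) ℂ :=
  let e : Fin N ⊕ Fin (d - N) ≃ Fin d :=
    finSumFinEquiv.trans (finCongr (Nat.add_sub_of_le h))
  Matrix.reindex e e
    (Matrix.fromBlocks (Matrix.diagonal fun α => Complex.exp (φ α * Complex.I)) 0 0 V)

theorem blockMatrix_mem {d N : ℕ} (h : N ≤ d) (φ : Fin N → ℝ)
    (V : Matrix.unitaryGroup (Fin (d - N)) ℂ) :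
    blockMatrix h φ (V : Matrix (Fin (d - N)) (Fin (d - N)) ℂ) ∈
      Matrix.unitaryGroup (Fin d) ℂ := by
  have hV := Matrix.mem_unitaryGroup_iff.mp V.2
  rw [Matrix.star_eq_conjTranspose] at hV
  rw [Matrix.mem_unitaryGroup_iff, Matrix.star_eq_conjTranspose]
  simp only [blockMatrix, Matrix.reindex_apply, Matrix.conjTranspose_submatrix,
    Matrix.submatrix_mul_equiv, Matrix.fromBlocks_conjTranspose, Matrix.fromBlocks_multiply,
    Matrix.diagonal_conjTranspose, Matrix.diagonal_mul_diagonal, Matrix.conjTranspose_zero,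
    Matrix.mul_zero, Matrix.zero_mul, add_zero, zero_add, hV]
  have hd : (Matrix.diagonal fun i : Fin N => Complex.exp (φ i * Complex.I) *
      (star fun α => Complex.exp (φ α * Complex.I)) i) = 1 := by
    rw [← Matrix.diagonal_one]
    congr 1
    funext i
    simp [← Complex.exp_conj, ← Complex.exp_add]
  rw [hd, Matrix.fromBlocks_one, Matrix.submatrix_one_equiv]

/-- The unitary `diag(e^{iφ₁}, …, e^{iφ_N}) ⊕ V` for `V ∈ U(d - N)`. -/
def blockUnitary {d N : ℕ} (h : N ≤ d)
    (x : (Fin N → ℝ) × Matrix.unitaryGroup (Fin (d - N)) ℂ) : Matrix.unitaryGroup (Fin d) ℂ :=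
  ⟨blockMatrix h x.1 x.2, blockMatrix_mem h x.1 x.2⟩

/-- The restricted Haar ensemble: the law of `diag(e^{iφ₁}, …, e^{iφ_N}) ⊕ V` for independent
uniform phases `φ_α` and an independent Haar random `V ∈ U(d - N)`. -/
def restrictedHaarEnsemble {d N : ℕ} (h : N ≤ d) : Measure (Matrix.unitaryGroup (Fin d) ℂ) :=
  ((uniformPhases N).prod (haarEnsemble (Fin (d - N)))).map (blockUnitary h)

/-- The `k`-th order frame potential `∫∫ |tr(U† U')|^{2k} dU dU'` of an ensemble of unitaries. -/
def framePotential {n : Type*} [Fintype n] [DecidableEq n] (k : ℕ)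
    (μ : Measure (Matrix.unitaryGroup n ℂ)) : ℝ :=
  ∫ U, ∫ U', ‖Matrix.trace
    ((U : Matrix n n ℂ).conjTranspose * (U' : Matrix n n ℂ))‖ ^ (2 * k) ∂μ ∂μ

end

/-! The trace of `U†U'` for two block unitaries is `tr(V†V')` plus a sum of `N` unimodular numbers
carrying the phases of `U'`. Averaging over these phases (`integral_uniformPhases_norm_pow_four`)
leaves `|z|^4 + 4N|z|^2 + 2N^2 - N` with `z = tr(V†V')`, and left invariance of Haar measure
replaces `z` by `tr V`. It remains to find `E|tr V|^2` and `E|tr V|^4` on `U(n)`, `n = d - N`.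

For `n ≥ 2` these are 1 and 2, obtained from left invariance alone. Multiplying by diagonal
unitaries introduces random phases on the rows, so the same formula reduces both to moments of
squared moduli of entries. Permutation matrices identify those moments up to row relabelling, unit
rows and columns fix their sums, and one explicit rotation gives `E|V_ia|^4 = 2 E|V_ia|^2|V_ja|^2`
(`entryMoment_self`). For `n ≤ 1` the trace has constant modulus `n`. -/

instance uniformPhase_isProbabilityMeasure :
    IsProbabilityMeasure (ProbabilityTheory.cond volume (Set.Ico 0 (2 * Real.pi))) := by
  apply ProbabilityTheory.cond_isProbabilityMeasure_of_finite
  · simp [Real.pi_pos]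
  · simp [ENNReal.mul_eq_top]

instance uniformPhases_isProbabilityMeasure (N : ℕ) :
    IsProbabilityMeasure (uniformPhases N) := by
  unfold uniformPhases
  infer_instance

/-! ### Moments of sums with independent uniform phases -/

theorem integral_uniformPhase (f : ℝ → ℝ) :
    ∫ t, f t ∂(ProbabilityTheory.cond volume (Set.Ico 0 (2 * Real.pi))) =
      (2 * Real.pi)⁻¹ * ∫ t in (0 : ℝ)..(2 * Real.pi), f t := by
  have hpi := Real.pi_pos
  rw [ProbabilityTheory.cond, integral_smul_measure,
    intervalIntegral.integral_of_le (by positivity), integral_Ico_eq_integral_Ioc]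
  simp [ENNReal.toReal_inv, ENNReal.toReal_ofReal, hpi.le]

theorem norm_add_mul_exp_sq (z x : ℂ) (t : ℝ) :
    ‖z + x * Complex.exp (t * Complex.I)‖ ^ 2 =
      ‖z‖ ^ 2 + ‖x‖ ^ 2 + 2 * ((z.re * x.re + z.im * x.im) * Real.cos t +
        (z.im * x.re - z.re * x.im) * Real.sin t) := by
  simp only [← Complex.normSq_eq_norm_sq, Complex.normSq_apply, Complex.exp_mul_I,
    ← Complex.ofReal_cos, ← Complex.ofReal_sin, Complex.add_re, Complex.add_im, Complex.mul_re,
    Complex.mul_im, Complex.ofReal_re, Complex.ofReal_im, Complex.I_re, Complex.I_im]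
  linear_combination (x.re ^ 2 + x.im ^ 2) * Real.sin_sq_add_cos_sq t

theorem integral_trig_quadratic (s a b : ℝ) :
    ∫ t in (0 : ℝ)..(2 * Real.pi), (s + 2 * (a * Real.cos t + b * Real.sin t)) ^ 2 =
      2 * Real.pi * (s ^ 2 + 2 * (a ^ 2 + b ^ 2)) := by
  -- Explicit antiderivative; only its linear term fails to be `2π`-periodic, and it gives the
  -- value.
  have key : ∀ t : ℝ, HasDerivAt (fun t => (s ^ 2 + 2 * (a ^ 2 + b ^ 2)) * t +
      4 * s * (a * Real.sin t - b * Real.cos t) + 2 * (a ^ 2 - b ^ 2) * (Real.sin t * Real.cos t)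
      + 4 * a * b * Real.sin t ^ 2)
      ((s + 2 * (a * Real.cos t + b * Real.sin t)) ^ 2) t := by
    intro t
    have hs := Real.hasDerivAt_sin t
    have hc := Real.hasDerivAt_cos t
    refine HasDerivAt.congr_deriv (((((hasDerivAt_id t).const_mul (s ^ 2 + 2 * (a ^ 2 + b ^ 2))).add
      (((hs.const_mul a).sub (hc.const_mul b)).const_mul (4 * s))).add
      ((hs.mul hc).const_mul (2 * (a ^ 2 - b ^ 2)))).add ((hs.pow 2).const_mul (4 * a * b))) ?_
    push_cast
    linear_combination (-2 * (a ^ 2 + b ^ 2)) * Real.sin_sq_add_cos_sq t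
  rw [intervalIntegral.integral_eq_sub_of_hasDerivAt (fun t _ => key t)
    (Continuous.intervalIntegrable (by fun_prop) _ _)]
  simp
  ring

theorem integral_uniformPhase_norm_sq (z x : ℂ) :
    ∫ t : ℝ, ‖z + x * Complex.exp (t * Complex.I)‖ ^ 2
      ∂(ProbabilityTheory.cond volume (Set.Ico 0 (2 * Real.pi))) = ‖z‖ ^ 2 + ‖x‖ ^ 2 := by
  have hpi := Real.pi_pos
  simp only [integral_uniformPhase, norm_add_mul_exp_sq]
  rw [intervalIntegral.integral_add (by simp) (Continuous.intervalIntegrable (by fun_prop) _ _),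
    intervalIntegral.integral_const_mul, intervalIntegral.integral_add
    (Continuous.intervalIntegrable (by fun_prop) _ _)
    (Continuous.intervalIntegrable (by fun_prop) _ _)]
  simp
  field_simp

theorem integral_uniformPhase_norm_pow_four (z x : ℂ) :
    ∫ t : ℝ, ‖z + x * Complex.exp (t * Complex.I)‖ ^ 4
      ∂(ProbabilityTheory.cond volume (Set.Ico 0 (2 * Real.pi))) =
      ‖z‖ ^ 4 + 4 * ‖z‖ ^ 2 * ‖x‖ ^ 2 + ‖x‖ ^ 4 := by
  have hpi := Real.pi_pos
  have h4 : ∀ y : ℂ, ‖y‖ ^ 4 = (‖y‖ ^ 2) ^ 2 := fun y => by ring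
  simp only [integral_uniformPhase, h4, norm_add_mul_exp_sq, integral_trig_quadratic]
  have hz : ‖z‖ ^ 2 = z.re ^ 2 + z.im ^ 2 := by
    rw [← Complex.normSq_eq_norm_sq, Complex.normSq_apply]; ring
  have hx : ‖x‖ ^ 2 = x.re ^ 2 + x.im ^ 2 := by
    rw [← Complex.normSq_eq_norm_sq, Complex.normSq_apply]; ring
  rw [hz, hx]
  field_simp
  ring

theorem norm_add_sum_mul_exp_le {N : ℕ} (z : ℂ) (x : Fin N → ℂ) (φ : Fin N → ℝ) :
    ‖z + ∑ k, x k * Complex.exp (φ k * Complex.I)‖ ≤ ‖z‖ + ∑ k, ‖x k‖ := by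
  refine (norm_add_le _ _).trans (add_le_add le_rfl ((norm_sum_le _ _).trans ?_))
  simp [Complex.norm_exp_ofReal_mul_I]

/-- Fubini splits off the first phase, which is absorbed into the constant `z`; this is the
induction step for both moments. -/
theorem integral_uniformPhases_succ {N : ℕ} (p : ℕ) (z : ℂ) (x : Fin (N + 1) → ℂ) :
    ∫ φ : Fin (N + 1) → ℝ, ‖z + ∑ k, x k * Complex.exp (φ k * Complex.I)‖ ^ p
      ∂(uniformPhases (N + 1)) =
    ∫ t : ℝ, ∫ φ : Fin N → ℝ,
      ‖z + x 0 * Complex.exp (t * Complex.I) +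
        ∑ k : Fin N, x k.succ * Complex.exp (φ k * Complex.I)‖ ^ p ∂(uniformPhases N)
      ∂(ProbabilityTheory.cond volume (Set.Ico 0 (2 * Real.pi))) := by
  have h := measurePreserving_piFinSuccAbove (n := N) (α := fun _ => ℝ)
    (fun _ => ProbabilityTheory.cond volume (Set.Ico 0 (2 * Real.pi))) 0
  let g : ℝ × (Fin N → ℝ) → ℝ := fun y => ‖z + x 0 * Complex.exp (y.1 * Complex.I) +
        ∑ k : Fin N, x k.succ * Complex.exp (y.2 k * Complex.I)‖ ^ p
  have hg : Integrable g ((ProbabilityTheory.cond volume (Set.Ico 0 (2 * Real.pi))).prod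
      (uniformPhases N)) := by
    refine Integrable.of_bound (C := (‖z‖ + ‖x 0‖ + ∑ k : Fin N, ‖x k.succ‖) ^ p)
      (Continuous.aestronglyMeasurable (by fun_prop)) (Filter.Eventually.of_forall fun φ => ?_)
    rw [Real.norm_of_nonneg (by positivity)]
    refine pow_le_pow_left₀ (norm_nonneg _) ((norm_add_sum_mul_exp_le _ _ _).trans ?_) p
    gcongr
    refine (norm_add_le _ _).trans ?_
    simp [Complex.norm_exp_ofReal_mul_I]
  rw [← integral_prod g hg]
  refine Eq.trans ?_ (h.integral_comp' g)
  refine integral_congr_ae (Filter.Eventually.of_forall fun φ => ?_)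
  simp [g, Fin.sum_univ_succ, MeasurableEquiv.piFinSuccAbove, Fin.insertNthEquiv,
    Fin.tail, add_assoc]

theorem integrable_uniformPhase (p : ℕ) (z x : ℂ) :
    Integrable (fun t : ℝ => ‖z + x * Complex.exp (t * Complex.I)‖ ^ p)
      (ProbabilityTheory.cond volume (Set.Ico 0 (2 * Real.pi))) := by
  refine Integrable.of_bound (C := (‖z‖ + ‖x‖) ^ p)
    (Continuous.aestronglyMeasurable (by fun_prop)) (Filter.Eventually.of_forall fun φ => ?_)
  rw [Real.norm_of_nonneg (by positivity)]
  refine pow_le_pow_left₀ (norm_nonneg _) ((norm_add_le _ _).trans ?_) p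
  simp [Complex.norm_exp_ofReal_mul_I]

theorem integral_uniformPhases_norm_sq {N : ℕ} (z : ℂ) (x : Fin N → ℂ) :
    ∫ φ : Fin N → ℝ, ‖z + ∑ k, x k * Complex.exp (φ k * Complex.I)‖ ^ 2 ∂(uniformPhases N) =
      ‖z‖ ^ 2 + ∑ k, ‖x k‖ ^ 2 := by
  induction N generalizing z with
  | zero => simp
  | succ N ih =>
    simp only [integral_uniformPhases_succ, ih]
    rw [integral_add (integrable_uniformPhase _ _ _) (integrable_const _),
      integral_uniformPhase_norm_sq, Fin.sum_univ_succ]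
    simp [add_assoc]

/-- In the expansion only terms whose phases cancel survive. For the `x`-only part there are two
pairings, which count the all-equal terms twice; hence the subtracted sum. -/
theorem integral_uniformPhases_norm_pow_four {N : ℕ} (z : ℂ) (x : Fin N → ℂ) :
    ∫ φ : Fin N → ℝ, ‖z + ∑ k, x k * Complex.exp (φ k * Complex.I)‖ ^ 4 ∂(uniformPhases N) =
      ‖z‖ ^ 4 + 4 * ‖z‖ ^ 2 * (∑ k, ‖x k‖ ^ 2) + 2 * (∑ k, ‖x k‖ ^ 2) ^ 2 - ∑ k, ‖x k‖ ^ 4 := by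
  induction N generalizing z with
  | zero => simp
  | succ N ih =>
    simp only [integral_uniformPhases_succ, ih, add_sub_assoc]
    have h2 : Integrable (fun t : ℝ => 4 * ‖z + x 0 * Complex.exp (t * Complex.I)‖ ^ 2 *
        ∑ k : Fin N, ‖x k.succ‖ ^ 2)
        (ProbabilityTheory.cond volume (Set.Ico 0 (2 * Real.pi))) :=
      ((integrable_uniformPhase 2 z (x 0)).const_mul 4).mul_const _
    have h4 := integrable_uniformPhase 4 z (x 0)
    rw [integral_add (h4.fun_add h2) (integrable_const _), integral_add h4 h2, integral_mul_const,
      integral_const_mul, integral_uniformPhase_norm_sq, integral_uniformPhase_norm_pow_four,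
      integral_const, Fin.sum_univ_succ, Fin.sum_univ_succ]
    simp only [probReal_univ, one_smul]
    ring

/-! ### Haar measure and the unitaries used for its invariance -/

open Matrix

instance matrix_secondCountableTopology (m n : Type*) [Fintype m] [Fintype n] :
    SecondCountableTopology (Matrix m n ℂ) :=
  inferInstanceAs (SecondCountableTopology (m → n → ℂ))

instance haarEnsemble_isProbabilityMeasure (n : Type*) [Fintype n] [DecidableEq n] :
    IsProbabilityMeasure (haarEnsemble n) :=
  ⟨by simpa [haarEnsemble] using
    Measure.haarMeasure_self (K₀ := (⊤ : TopologicalSpace.PositiveCompacts (unitaryGroup n ℂ)))⟩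

instance haarEnsemble_isMulLeftInvariant (n : Type*) [Fintype n] [DecidableEq n] :
    (haarEnsemble n).IsMulLeftInvariant := by
  unfold haarEnsemble
  infer_instance

theorem continuous_unitaryGroup_apply {n : Type*} [Fintype n] [DecidableEq n] (i j : n) :
    Continuous fun V : unitaryGroup n ℂ => (V : Matrix n n ℂ) i j :=
  continuous_subtype_val.matrix_elem i j

theorem integrable_haarEnsemble {n : Type*} [Fintype n] [DecidableEq n]
    {f : unitaryGroup n ℂ → ℝ} (hf : Continuous f) : Integrable f (haarEnsemble n) :=
  hf.integrable_of_hasCompactSupport (HasCompactSupport.of_compactSpace f)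

/-- The diagonal unitary with phases `φ`. -/
noncomputable def phaseUnitary {n : ℕ} (φ : Fin n → ℝ) : unitaryGroup (Fin n) ℂ :=
  ⟨diagonal fun k => Complex.exp (φ k * Complex.I), by
    rw [mem_unitaryGroup_iff, star_eq_conjTranspose, diagonal_conjTranspose,
      diagonal_mul_diagonal, ← diagonal_one]
    congr 1
    funext i
    simp [← Complex.exp_conj, ← Complex.exp_add]⟩

/-- The permutation matrix of `σ` as a unitary. -/
noncomputable def permUnitary {n : Type*} [Fintype n] [DecidableEq n] (σ : Equiv.Perm n) :
    unitaryGroup n ℂ :=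
  ⟨σ.permMatrix ℂ, by
    rw [mem_unitaryGroup_iff, star_eq_conjTranspose, conjTranspose_permMatrix, ← permMatrix_mul,
      inv_mul_cancel, permMatrix_one]⟩

theorem permUnitary_mul_apply {n : Type*} [Fintype n] [DecidableEq n] (σ : Equiv.Perm n)
    (V : unitaryGroup n ℂ) (i j : n) :
    (permUnitary σ * V : unitaryGroup n ℂ).1 i j = V.1 (σ i) j := by
  simp [permUnitary, Equiv.Perm.permMatrix, PEquiv.toMatrix_toPEquiv_mul]

/-- A rational unitary mixing two rows with both weights nonzero, which is all that
`entryMoment_self` needs. -/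
theorem exists_unitary_row {n : Type*} [Fintype n] [DecidableEq n] {i j : n} (h : i ≠ j) :
    ∃ H : unitaryGroup n ℂ, ∀ (V : unitaryGroup n ℂ) (a : n),
      (H * V).1 i a = 3 / 5 * V.1 i a + 4 / 5 * V.1 j a := by
  -- Householder reflection `1 - 2vvᵀ/(v·v)` with `v·v = 5`; its row `i` is `(1 - 2/5, 4/5)`.
  let v : n → ℂ := Pi.single i 1 - (2 : ℂ) • Pi.single j 1
  have hvv : v ⬝ᵥ v = 5 := by
    simp [v, dotProduct_sub, h]
    norm_num
  have hH : (1 - (2 / 5 : ℂ) • vecMulVec v v) * (1 - (2 / 5 : ℂ) • vecMulVec v v) = 1 := by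
    have : vecMulVec v v * vecMulVec v v = (5 : ℂ) • vecMulVec v v := by
      rw [vecMulVec_mul_vecMulVec, hvv]
      ext; simp [vecMulVec_apply, mul_left_comm]
    simp only [sub_mul, mul_sub, one_mul, mul_one, smul_mul_assoc, mul_smul_comm, this, smul_smul]
    module
  have hs : (1 - (2 / 5 : ℂ) • vecMulVec v v)ᴴ = 1 - (2 / 5 : ℂ) • vecMulVec v v := by
    have : star v = v := by
      ext k
      simp only [v, Pi.star_apply, Pi.sub_apply, Pi.smul_apply, Pi.single_apply]
      split_ifs <;> simp
    simp [conjTranspose_vecMulVec, this]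
  refine ⟨⟨1 - (2 / 5 : ℂ) • vecMulVec v v, ?_⟩, fun V a => ?_⟩
  · rw [mem_unitaryGroup_iff, star_eq_conjTranspose, hs, hH]
  · have h1 : (vecMulVec v v * V.1) i a = V.1 i a - 2 * V.1 j a := by
      simp [mul_apply, vecMulVec_apply, v, sub_mul, Finset.sum_sub_distrib, h, Pi.single_apply]
    simp only [Submonoid.coe_mul, sub_mul, one_mul, smul_mul_assoc, Matrix.sub_apply,
      Matrix.smul_apply, h1, smul_eq_mul]
    ring

theorem sum_col_norm_sq {n : Type*} [Fintype n] [DecidableEq n] (V : unitaryGroup n ℂ) (a : n) :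
    ∑ i, ‖V.1 i a‖ ^ 2 = 1 := by
  have h := congrFun (congrFun (mem_unitaryGroup_iff'.mp V.2) a) a
  rw [star_eq_conjTranspose, mul_apply] at h
  simp only [conjTranspose_apply, RCLike.star_def, one_apply_eq, RCLike.conj_mul] at h
  exact Complex.ofReal_injective (by simpa using h)

theorem sum_row_norm_sq {n : Type*} [Fintype n] [DecidableEq n] (V : unitaryGroup n ℂ) (i : n) :
    ∑ a, ‖V.1 i a‖ ^ 2 = 1 := by
  have h := congrFun (congrFun (mem_unitaryGroup_iff.mp V.2) i) i
  rw [star_eq_conjTranspose, mul_apply] at h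
  simp only [conjTranspose_apply, RCLike.star_def, one_apply_eq, RCLike.mul_conj] at h
  exact Complex.ofReal_injective (by simpa using h)

theorem integrable_haarEnsemble_prod_phases {n : ℕ} (p : ℕ) (x : Fin n → ℂ)
    (f : Fin n → Fin n) :
    Integrable (fun y : unitaryGroup (Fin n) ℂ × (Fin n → ℝ) =>
      ‖0 + ∑ k, (x k * y.1.1 k (f k)) * Complex.exp (y.2 k * Complex.I)‖ ^ p)
      ((haarEnsemble (Fin n)).prod (uniformPhases n)) := by
  have hc : ∀ k, Continuous fun y : unitaryGroup (Fin n) ℂ × (Fin n → ℝ) => y.1.1 k (f k) :=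
    fun k => (continuous_unitaryGroup_apply k (f k)).comp continuous_fst
  have he : ∀ k, Continuous fun y : unitaryGroup (Fin n) ℂ × (Fin n → ℝ) =>
      Complex.exp (y.2 k * Complex.I) := fun k => by fun_prop
  refine Integrable.of_bound (C := (‖(0 : ℂ)‖ + ∑ k, ‖x k‖) ^ p)
    (Continuous.aestronglyMeasurable ?_) (Filter.Eventually.of_forall fun y => ?_)
  · exact (continuous_const.add (continuous_finsetSum _ fun k _ =>
      (continuous_const.mul (hc k)).mul (he k))).norm.pow p
  · rw [norm_pow, norm_norm]
    refine pow_le_pow_left₀ (norm_nonneg _) ((norm_add_sum_mul_exp_le _ _ _).trans ?_) p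
    gcongr with k
    rw [norm_mul]
    exact mul_le_of_le_one_right (norm_nonneg _) (entry_norm_bound_of_unitary y.1.2 _ _)

/-- Left multiplication by a diagonal unitary puts a phase on each row without changing the
integral, so one may average over the phases. Here `f` picks one entry per row: the identity gives
the trace, a constant gives a column. -/
theorem integral_haarEnsemble_eq_integral_phases {n : ℕ} (p : ℕ) (x : Fin n → ℂ)
    (f : Fin n → Fin n) :
    ∫ V, ‖∑ k, x k * V.1 k (f k)‖ ^ p ∂(haarEnsemble (Fin n)) =
      ∫ V, ∫ φ : Fin n → ℝ, ‖0 + ∑ k, (x k * V.1 k (f k)) * Complex.exp (φ k * Complex.I)‖ ^ p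
        ∂(uniformPhases n) ∂(haarEnsemble (Fin n)) := by
  rw [integral_integral_swap]
  · have h : ∀ φ : Fin n → ℝ, ∫ V,
        ‖0 + ∑ k, (x k * V.1 k (f k)) * Complex.exp (φ k * Complex.I)‖ ^ p
        ∂(haarEnsemble (Fin n)) = ∫ V, ‖∑ k, x k * V.1 k (f k)‖ ^ p ∂(haarEnsemble (Fin n)) := by
      intro φ
      refine Eq.trans ?_ (integral_mul_left_eq_self
        (fun V : unitaryGroup (Fin n) ℂ => ‖∑ k, x k * V.1 k (f k)‖ ^ p) (phaseUnitary φ))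
      simp only [phaseUnitary, Submonoid.coe_mul, diagonal_mul, zero_add, mul_assoc,
        mul_comm (Complex.exp _)]
    simp only [h, integral_const, probReal_univ, one_smul]
  · exact integrable_haarEnsemble_prod_phases p x f

theorem integral_haarEnsemble_norm_sum_pow_four {n : ℕ} (x : Fin n → ℂ) (f : Fin n → Fin n) :
    ∫ V, ‖∑ k, x k * V.1 k (f k)‖ ^ 4 ∂(haarEnsemble (Fin n)) =
      ∫ V, (2 * (∑ k, ‖x k‖ ^ 2 * ‖V.1 k (f k)‖ ^ 2) ^ 2 -
        ∑ k, (‖x k‖ ^ 2 * ‖V.1 k (f k)‖ ^ 2) ^ 2) ∂(haarEnsemble (Fin n)) := by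
  rw [integral_haarEnsemble_eq_integral_phases]
  simp only [integral_uniformPhases_norm_pow_four]
  congr 1
  funext V
  have h4 : ∀ y : ℂ, ‖y‖ ^ 4 = (‖y‖ ^ 2) ^ 2 := fun y => by ring
  simp [h4, mul_pow]

theorem integral_haarEnsemble_norm_sum_sq {n : ℕ} (x : Fin n → ℂ) (f : Fin n → Fin n) :
    ∫ V, ‖∑ k, x k * V.1 k (f k)‖ ^ 2 ∂(haarEnsemble (Fin n)) =
      ∫ V, (∑ k, ‖x k‖ ^ 2 * ‖V.1 k (f k)‖ ^ 2) ∂(haarEnsemble (Fin n)) := by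
  rw [integral_haarEnsemble_eq_integral_phases]
  simp only [integral_uniformPhases_norm_sq]
  simp [mul_pow]

theorem exists_perm_apply_eq_apply_eq {n : Type*} [DecidableEq n] {i j k l : n} (hij : i ≠ j)
    (hkl : k ≠ l) : ∃ σ : Equiv.Perm n, σ k = i ∧ σ l = j := by
  have hm : i ≠ Equiv.swap k i l := by
    intro h
    apply hkl
    apply (Equiv.swap k i).injective
    rw [← h, Equiv.swap_apply_left]
  refine ⟨Equiv.swap (Equiv.swap k i l) j * Equiv.swap k i, ?_, ?_⟩
  · rw [Equiv.Perm.mul_apply, Equiv.swap_apply_left, Equiv.swap_apply_of_ne_of_ne hm hij]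
  · rw [Equiv.Perm.mul_apply, Equiv.swap_apply_left]

theorem integral_haarEnsemble_perm {n : Type*} [Fintype n] [DecidableEq n] (σ : Equiv.Perm n)
    (g : Matrix n n ℂ → ℝ) :
    ∫ V, g (V.1.submatrix σ id) ∂(haarEnsemble n) = ∫ V, g V.1 ∂(haarEnsemble n) := by
  refine Eq.trans ?_ (integral_mul_left_eq_self (fun V : unitaryGroup n ℂ => g V.1)
    (permUnitary σ))
  congr 1
  funext V
  congr 1
  ext i j
  exact (permUnitary_mul_apply σ V i j).symm

/-! ### Moments of entries and of the trace -/

theorem continuous_norm_sq_apply {n : Type*} [Fintype n] [DecidableEq n] (i a : n) :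
    Continuous fun V : unitaryGroup n ℂ => ‖V.1 i a‖ ^ 2 :=
  (continuous_unitaryGroup_apply i a).norm.pow 2

theorem integral_norm_sq_apply {n : Type*} [Fintype n] [DecidableEq n] (i a : n) :
    ∫ V, ‖V.1 i a‖ ^ 2 ∂(haarEnsemble n) = (Fintype.card n : ℝ)⁻¹ := by
  have h1 : ∑ j, ∫ V, ‖V.1 j a‖ ^ 2 ∂(haarEnsemble n) = 1 := by
    rw [← integral_finsetSum _ fun j _ => integrable_haarEnsemble (continuous_norm_sq_apply j a)]
    simp [sum_col_norm_sq]
  have h2 : ∀ j, ∫ V, ‖V.1 j a‖ ^ 2 ∂(haarEnsemble n) = ∫ V, ‖V.1 i a‖ ^ 2 ∂(haarEnsemble n) := by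
    intro j
    rw [← integral_haarEnsemble_perm (Equiv.swap i j) fun M => ‖M i a‖ ^ 2]
    simp
  simp only [h2, Finset.sum_const, Finset.card_univ, nsmul_eq_mul] at h1
  exact eq_inv_of_mul_eq_one_right h1

/-- The mixed second moment of the squared moduli of two entries of a Haar unitary. -/
noncomputable def entryMoment {n : Type*} [Fintype n] [DecidableEq n] (i a j b : n) : ℝ :=
  ∫ V, ‖V.1 i a‖ ^ 2 * ‖V.1 j b‖ ^ 2 ∂(haarEnsemble n)

theorem integrable_entryMoment {n : Type*} [Fintype n] [DecidableEq n] (i a j b : n) :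
    Integrable (fun V : unitaryGroup n ℂ => ‖V.1 i a‖ ^ 2 * ‖V.1 j b‖ ^ 2) (haarEnsemble n) :=
  integrable_haarEnsemble ((continuous_norm_sq_apply i a).mul (continuous_norm_sq_apply j b))

theorem sum_entryMoment {n : Type*} [Fintype n] [DecidableEq n] (i a j : n) :
    ∑ b, entryMoment i a j b = (Fintype.card n : ℝ)⁻¹ := by
  simp only [entryMoment]
  rw [← integral_finsetSum _ fun b _ => integrable_entryMoment i a j b]
  simp only [← Finset.mul_sum, sum_row_norm_sq, mul_one, integral_norm_sq_apply]

theorem entryMoment_diag_eq {n : Type*} [Fintype n] [DecidableEq n] (i j a b : n) :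
    entryMoment i a i b = entryMoment j a j b := by
  simp only [entryMoment]
  rw [← integral_haarEnsemble_perm (Equiv.swap i j) fun M => ‖M i a‖ ^ 2 * ‖M i b‖ ^ 2]
  simp

theorem entryMoment_off_diag_eq {n : Type*} [Fintype n] [DecidableEq n] {i j k l : n}
    (hij : i ≠ j) (hkl : k ≠ l) (a b : n) :
    entryMoment i a j b = entryMoment k a l b := by
  obtain ⟨σ, rfl, rfl⟩ := exists_perm_apply_eq_apply_eq hij hkl
  simp only [entryMoment]
  rw [← integral_haarEnsemble_perm σ fun M => ‖M k a‖ ^ 2 * ‖M l b‖ ^ 2]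
  simp

/-- Rotate row `i` into `3/5` of itself plus `4/5` of row `j`, then average over row phases. With
`M`, `P` the two moments this reads `M = (81 + 256)/625 M + 576/625 P`, whence `M = 2P`. -/
theorem entryMoment_self {n : ℕ} {i j : Fin n} (hij : i ≠ j) (a : Fin n) :
    entryMoment i a i a = 2 * entryMoment i a j a := by
  obtain ⟨H, hH⟩ := exists_unitary_row hij
  let x : Fin n → ℂ := fun k => if k = i then 3 / 5 else if k = j then 4 / 5 else 0
  have hxi : x i = 3 / 5 := by simp [x]
  have hxj : x j = 4 / 5 := by simp [x, hij.symm]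
  have hx0 : ∀ k, k ≠ i ∧ k ≠ j → x k = 0 := fun k hk => by simp [x, hk.1, hk.2]
  have h1 : entryMoment i a i a =
      ∫ V, ‖∑ k, x k * V.1 k a‖ ^ 4 ∂(haarEnsemble (Fin n)) := by
    have := integral_mul_left_eq_self (μ := haarEnsemble (Fin n))
      (fun V : unitaryGroup (Fin n) ℂ => ‖V.1 i a‖ ^ 2 * ‖V.1 i a‖ ^ 2) H
    rw [entryMoment, ← this]
    congr 1
    funext V
    rw [hH, Fintype.sum_eq_add i j hij fun k hk => by rw [hx0 k hk, zero_mul], hxi, hxj]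
    ring
  have h2 : ∀ V : unitaryGroup (Fin n) ℂ,
      2 * (∑ k, ‖x k‖ ^ 2 * ‖V.1 k a‖ ^ 2) ^ 2 - ∑ k, (‖x k‖ ^ 2 * ‖V.1 k a‖ ^ 2) ^ 2 =
      81 / 625 * (‖V.1 i a‖ ^ 2 * ‖V.1 i a‖ ^ 2) + 576 / 625 * (‖V.1 i a‖ ^ 2 * ‖V.1 j a‖ ^ 2)
        + 256 / 625 * (‖V.1 j a‖ ^ 2 * ‖V.1 j a‖ ^ 2) := by
    intro V
    rw [Fintype.sum_eq_add i j hij fun k hk => by simp [hx0 k hk],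
      Fintype.sum_eq_add i j hij fun k hk => by simp [hx0 k hk], hxi, hxj]
    norm_num
    ring
  rw [integral_haarEnsemble_norm_sum_pow_four x fun _ => a] at h1
  simp only [h2] at h1
  rw [integral_add (((integrable_entryMoment i a i a).const_mul _).fun_add
      ((integrable_entryMoment i a j a).const_mul _)) ((integrable_entryMoment j a j a).const_mul _),
    integral_add ((integrable_entryMoment i a i a).const_mul _)
      ((integrable_entryMoment i a j a).const_mul _),
    integral_const_mul, integral_const_mul, integral_const_mul] at h1
  have h3 := entryMoment_diag_eq i j a a
  simp only [entryMoment] at h1 h3 ⊢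
  linarith

theorem integral_norm_trace_sq {n : ℕ} (hn : n ≠ 0) :
    ∫ V, ‖trace V.1‖ ^ 2 ∂(haarEnsemble (Fin n)) = 1 := by
  have h := integral_haarEnsemble_norm_sum_sq (fun _ : Fin n => 1) id
  simp only [one_mul, norm_one, one_pow, id] at h
  simp only [trace, diag_apply]
  rw [h, integral_finsetSum _ fun j _ => integrable_haarEnsemble (continuous_norm_sq_apply j j)]
  simp [integral_norm_sq_apply, hn]

theorem integral_norm_trace_pow_four {n : ℕ} (hn : 2 ≤ n) :
    ∫ V, ‖trace V.1‖ ^ 4 ∂(haarEnsemble (Fin n)) = 2 := by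
  have h := integral_haarEnsemble_norm_sum_pow_four (fun _ : Fin n => 1) id
  simp only [one_mul, norm_one, one_pow, id] at h
  simp only [trace, diag_apply]
  have hexp : ∀ V : unitaryGroup (Fin n) ℂ,
      2 * (∑ k, ‖V.1 k k‖ ^ 2) ^ 2 - ∑ k, (‖V.1 k k‖ ^ 2) ^ 2 =
      ∑ a, (2 * ∑ b, ‖V.1 a a‖ ^ 2 * ‖V.1 b b‖ ^ 2 - ‖V.1 a a‖ ^ 2 * ‖V.1 a a‖ ^ 2) := by
    intro V
    simp only [Finset.sum_sub_distrib, ← Finset.mul_sum, ← Finset.sum_mul, sq]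
  have hsum : ∀ a : Fin n, Integrable (fun V : unitaryGroup (Fin n) ℂ =>
      2 * ∑ b, ‖V.1 a a‖ ^ 2 * ‖V.1 b b‖ ^ 2) (haarEnsemble (Fin n)) := fun a =>
    (integrable_finsetSum _ fun b _ => integrable_entryMoment a a b b).const_mul 2
  have hsub : ∀ a : Fin n, Integrable (fun V : unitaryGroup (Fin n) ℂ =>
      2 * ∑ b, ‖V.1 a a‖ ^ 2 * ‖V.1 b b‖ ^ 2 - ‖V.1 a a‖ ^ 2 * ‖V.1 a a‖ ^ 2)
      (haarEnsemble (Fin n)) := fun a => (hsum a).sub (integrable_entryMoment a a a a)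
  have hterm : ∀ a : Fin n, 2 * ∑ b, entryMoment a a b b - entryMoment a a a a =
      2 * (n : ℝ)⁻¹ := by
    intro a
    have : Nontrivial (Fin n) := Fin.nontrivial_iff_two_le.mpr hn
    obtain ⟨j, hj⟩ := exists_ne a
    have h1 := sum_entryMoment a a j
    have h2 := entryMoment_self hj.symm a
    rw [← Finset.add_sum_erase _ _ (Finset.mem_univ a)] at h1 ⊢
    -- For `b ≠ a` the second row may be moved to the fixed row `j`, so the sum becomes a row sum
    -- with its `a`-term missing. The defect is `M - 2P`, which vanishes by `entryMoment_self`.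
    have h3 : ∑ b ∈ Finset.univ.erase a, entryMoment a a b b =
        ∑ b ∈ Finset.univ.erase a, entryMoment a a j b :=
      Finset.sum_congr rfl fun b hb =>
        entryMoment_off_diag_eq (Finset.ne_of_mem_erase hb).symm hj.symm a b
    rw [Fintype.card_fin] at h1
    rw [h3]
    linarith
  rw [h]
  simp only [hexp]
  rw [integral_finsetSum _ fun a _ => hsub a]
  have hint : ∀ a : Fin n, ∫ V, (2 * ∑ b, ‖V.1 a a‖ ^ 2 * ‖V.1 b b‖ ^ 2 -
      ‖V.1 a a‖ ^ 2 * ‖V.1 a a‖ ^ 2) ∂(haarEnsemble (Fin n)) = 2 * (n : ℝ)⁻¹ := by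
    intro a
    rw [integral_sub (hsum a) (integrable_entryMoment a a a a), integral_const_mul,
      integral_finsetSum _ fun b _ => integrable_entryMoment a a b b]
    exact hterm a
  simp only [hint, Finset.sum_const, Finset.card_univ, Fintype.card_fin, nsmul_eq_mul]
  have : (n : ℝ) ≠ 0 := by positivity
  field_simp

/-! ### Frame potentials -/

theorem continuous_blockUnitary {d N : ℕ} (h : N ≤ d) : Continuous (blockUnitary h) := by
  refine Continuous.subtype_mk ?_ _
  simp only [blockMatrix, reindex_apply]
  refine Continuous.matrix_submatrix (Continuous.matrix_fromBlocks ?_ continuous_const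
    continuous_const (continuous_subtype_val.comp continuous_snd)) _ _
  exact Continuous.matrix_diagonal (by fun_prop)

theorem trace_blockUnitary {d N : ℕ} (h : N ≤ d)
    (x y : (Fin N → ℝ) × unitaryGroup (Fin (d - N)) ℂ) :
    trace ((blockUnitary h x).1ᴴ * (blockUnitary h y).1) =
      trace (x.2.1ᴴ * y.2.1) + ∑ k, star (Complex.exp (x.1 k * Complex.I)) *
        Complex.exp (y.1 k * Complex.I) := by
  simp only [blockUnitary, blockMatrix, reindex_apply, conjTranspose_submatrix,
    submatrix_mul_equiv, fromBlocks_conjTranspose, fromBlocks_multiply, diagonal_conjTranspose,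
    diagonal_mul_diagonal, conjTranspose_zero, Matrix.mul_zero, Matrix.zero_mul, add_zero,
    zero_add]
  simp only [trace, diag_apply, submatrix_apply]
  rw [Equiv.sum_comp (Equiv.symm _) (fun i => fromBlocks (diagonal fun i =>
      star (fun α => Complex.exp (x.1 α * Complex.I)) i * Complex.exp (y.1 i * Complex.I))
    0 0 (x.2.1ᴴ * y.2.1) i i), Fintype.sum_sum_type, add_comm]
  simp

instance unitaryGroup_secondCountableTopology (n : Type*) [Fintype n] [DecidableEq n] :
    SecondCountableTopology (unitaryGroup n ℂ) :=
  Topology.IsEmbedding.subtypeVal.secondCountableTopology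

theorem continuous_norm_trace_pow {n : Type*} [Fintype n] [DecidableEq n] (p : ℕ) :
    Continuous fun x : unitaryGroup n ℂ × unitaryGroup n ℂ => ‖trace (x.1.1ᴴ * x.2.1)‖ ^ p :=
  (((continuous_subtype_val.comp continuous_fst).matrix_conjTranspose.matrix_mul
    (continuous_subtype_val.comp continuous_snd)).matrix_trace).norm.pow p

theorem continuous_norm_trace_conjTranspose_mul_pow {n : Type*} [Fintype n] [DecidableEq n]
    (p : ℕ) (U : unitaryGroup n ℂ) :
    Continuous fun V : unitaryGroup n ℂ => ‖trace (U.1ᴴ * V.1)‖ ^ p :=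
  ((continuous_const.matrix_mul continuous_subtype_val).matrix_trace).norm.pow p

theorem integral_norm_trace_conjTranspose_mul {n : Type*} [Fintype n] [DecidableEq n]
    (g : ℂ → ℝ) (U : unitaryGroup n ℂ) :
    ∫ V, g (trace (U.1ᴴ * V.1)) ∂(haarEnsemble n) = ∫ V, g (trace V.1) ∂(haarEnsemble n) :=
  integral_mul_left_eq_self (fun V : unitaryGroup n ℂ => g (trace V.1)) (star U)

theorem framePotential_haarEnsemble {n : Type*} [Fintype n] [DecidableEq n] (k : ℕ) :
    framePotential k (haarEnsemble n) = ∫ V, ‖trace V.1‖ ^ (2 * k) ∂(haarEnsemble n) := by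
  simp only [framePotential,
    integral_norm_trace_conjTranspose_mul (fun z => ‖z‖ ^ (2 * k)), integral_const,
    probReal_univ, one_smul]

/-- The phases of `x` enter only through coefficients of modulus one, and its unitary block is
removed by left invariance, so the inner integral is independent of `x`. -/
theorem integral_norm_trace_blockUnitary {d N : ℕ} (h : N ≤ d)
    (x : (Fin N → ℝ) × unitaryGroup (Fin (d - N)) ℂ) :
    ∫ y, ‖trace ((blockUnitary h x).1ᴴ * (blockUnitary h y).1)‖ ^ 4
        ∂((uniformPhases N).prod (haarEnsemble (Fin (d - N)))) =
      ∫ V, (‖trace V.1‖ ^ 4 + 4 * ‖trace V.1‖ ^ 2 * N + (2 * (N : ℝ) ^ 2 - N))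
        ∂(haarEnsemble (Fin (d - N))) := by
  have hmeas := (continuous_blockUnitary h).measurable
  have hcont := continuous_norm_trace_conjTranspose_mul_pow 4 (blockUnitary h x)
  have hint : Integrable (fun y => ‖trace ((blockUnitary h x).1ᴴ * (blockUnitary h y).1)‖ ^ 4)
      ((uniformPhases N).prod (haarEnsemble (Fin (d - N)))) :=
    (hcont.integrable_of_hasCompactSupport
      (HasCompactSupport.of_compactSpace _)).comp_measurable hmeas
  rw [integral_prod_symm _ hint]
  simp only [trace_blockUnitary, integral_uniformPhases_norm_pow_four, norm_star,
    Complex.norm_exp_ofReal_mul_I, one_pow, Finset.sum_const, Finset.card_univ, Fintype.card_fin,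
    nsmul_eq_mul, mul_one, add_sub_assoc]
  exact integral_norm_trace_conjTranspose_mul
    (fun z => ‖z‖ ^ 4 + 4 * ‖z‖ ^ 2 * N + (2 * (N : ℝ) ^ 2 - N)) x.2

theorem framePotential_restrictedHaarEnsemble {d N : ℕ} (h : N ≤ d) :
    framePotential 2 (restrictedHaarEnsemble h) =
      ∫ V, ‖trace V.1‖ ^ 4 ∂(haarEnsemble (Fin (d - N))) +
      4 * (∫ V, ‖trace V.1‖ ^ 2 ∂(haarEnsemble (Fin (d - N)))) * N + (2 * (N : ℝ) ^ 2 - N) := by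
  have hmeas := (continuous_blockUnitary h).measurable
  have hsm : StronglyMeasurable (Function.uncurry fun U U' : unitaryGroup (Fin d) ℂ =>
      ‖trace (U.1ᴴ * U'.1)‖ ^ 4) :=
    (continuous_norm_trace_pow 4).stronglyMeasurable
  have ht : Continuous fun V : unitaryGroup (Fin (d - N)) ℂ => trace V.1 :=
    continuous_subtype_val.matrix_trace
  have h4 : Integrable (fun V : unitaryGroup (Fin (d - N)) ℂ => ‖trace V.1‖ ^ 4)
      (haarEnsemble (Fin (d - N))) := integrable_haarEnsemble (ht.norm.pow 4)
  have h2 : Integrable (fun V : unitaryGroup (Fin (d - N)) ℂ => 4 * ‖trace V.1‖ ^ 2 * (N : ℝ))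
      (haarEnsemble (Fin (d - N))) :=
    ((integrable_haarEnsemble (ht.norm.pow 2)).const_mul 4).mul_const (N : ℝ)
  rw [framePotential]
  norm_num only
  rw [restrictedHaarEnsemble, integral_map hmeas.aemeasurable]
  · have hinner : ∀ x, ∫ U', ‖trace ((blockUnitary h x).1ᴴ * U'.1)‖ ^ 4
        ∂(Measure.map (blockUnitary h)
          ((uniformPhases N).prod (haarEnsemble (Fin (d - N))))) =
        ∫ V, (‖trace V.1‖ ^ 4 + 4 * ‖trace V.1‖ ^ 2 * N + (2 * (N : ℝ) ^ 2 - N))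
          ∂(haarEnsemble (Fin (d - N))) := by
      intro x
      rw [← integral_norm_trace_blockUnitary h x]
      exact integral_map hmeas.aemeasurable
        (continuous_norm_trace_conjTranspose_mul_pow 4 (blockUnitary h x)).aestronglyMeasurable
    simp only [hinner, integral_const, probReal_univ, one_smul]
    rw [integral_add (h4.fun_add h2) (integrable_const _), integral_add h4 h2,
      integral_mul_const, integral_const_mul]
    simp
  · exact hsm.integral_prod_right.aestronglyMeasurable

theorem framePotential_restrictedHaarEnsemble_of_add_two_le {d N : ℕ} (h : N ≤ d)
    (hd : N + 2 ≤ d) :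
    framePotential 2 (restrictedHaarEnsemble h) = 2 * (N : ℝ) ^ 2 + 3 * (N : ℝ) + 2 := by
  rw [framePotential_restrictedHaarEnsemble, integral_norm_trace_sq (by omega),
    integral_norm_trace_pow_four (by omega)]
  ring

theorem norm_trace_unitaryGroup_of_unique {n : Type*} [Fintype n] [DecidableEq n] [Unique n]
    (V : unitaryGroup n ℂ) : ‖trace V.1‖ = 1 := by
  have h := sum_row_norm_sq V default
  rw [Fintype.sum_unique] at h
  simpa [trace] using (pow_eq_one_iff_of_nonneg (norm_nonneg _) two_ne_zero).mp h

theorem framePotential_restrictedHaarEnsemble_of_le_add_one {d N : ℕ} (h : N ≤ d)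
    (hd : d ≤ N + 1) :
    framePotential 2 (restrictedHaarEnsemble h) = 2 * (d : ℝ) ^ 2 - (d : ℝ) := by
  rw [framePotential_restrictedHaarEnsemble]
  -- The block `V` is empty with trace 0, or a single number of modulus 1; the latter gives `1 + 4N
  -- + 2N² - N = 2(N+1)² - (N+1)`.
  obtain rfl | rfl : d = N ∨ d = N + 1 := by omega
  · have : IsEmpty (Fin (d - d)) := by rw [Nat.sub_self]; infer_instance
    simp [trace]
  · have : Unique (Fin (N + 1 - N)) := by rw [Nat.add_sub_cancel_left]; infer_instance
    simp only [norm_trace_unitaryGroup_of_unique, one_pow, integral_const, probReal_univ,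
      one_smul]
    push_cast
    ring

theorem mainTheorem3 :
    (∀ (d N : ℕ) (h : N ≤ d),
      (N + 2 ≤ d →
        framePotential 2 (restrictedHaarEnsemble h) = 2 * (N : ℝ) ^ 2 + 3 * (N : ℝ) + 2) ∧
      (d ≤ N + 1 →
        framePotential 2 (restrictedHaarEnsemble h) = 2 * (d : ℝ) ^ 2 - (d : ℝ))) ∧
    (∀ d : ℕ, 2 ≤ d → framePotential 2 (haarEnsemble (Fin d)) = 2) ∧
    (∀ (d N : ℕ) (h : N ≤ d), 2 ≤ d → 1 ≤ N →
      framePotential 2 (haarEnsemble (Fin d)) < framePotential 2 (restrictedHaarEnsemble h)) := by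
  have hH : ∀ d : ℕ, 2 ≤ d → framePotential 2 (haarEnsemble (Fin d)) = 2 := fun d hd => by
    rw [framePotential_haarEnsemble]
    exact integral_norm_trace_pow_four hd
  refine ⟨fun d N h => ⟨framePotential_restrictedHaarEnsemble_of_add_two_le h,
    framePotential_restrictedHaarEnsemble_of_le_add_one h⟩, hH, fun d N h hd hN => ?_⟩
  rw [hH d hd]
  have hN' : (1 : ℝ) ≤ N := by exact_mod_cast hN
  have hd' : (2 : ℝ) ≤ d := by exact_mod_cast hd
  rcases le_or_gt (N + 2) d with h1 | h1
  · rw [framePotential_restrictedHaarEnsemble_of_add_two_le h h1]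
    nlinarith
  · rw [framePotential_restrictedHaarEnsemble_of_le_add_one h (by omega)]
    nlinarith
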